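/- Let $\mathbb{R}^*=\mathbb{R}\setminus\{0\}$ and let $L$ be a bounded operator on $L^2(\mathbb{R}^*,dx)$ with integral kernel $$L(x,y)=\frac{A^{+}(x)A^{-}(y)+A^{-}(x)A^{+}(y)}{x-y},\qquad A^{+}=A\chi_{(0,\infty)},\quad A^{-}=A\chi_{(-\infty,0)},$$ where $A\in C^1(\mathbb{R}^*)\cap L^2(\mathbb{R}^*,dx)$ is real-valued and the (closed) support of $A$ in $\mathbb{R}^*$ is all of $\mathbb{R}^*$. Let $n\ge 0$ and let $\mathfrak p=(p_1^+,\dots,p_n^+;p_1^-,\dots,p_n^-)$ be a $2n$-tuple of distinct points with $p_i^+>0$, $p_i^-<0$ and $A(p_i^{\pm})\neq 0$ for all $i$. Define the bounded function $$g_{\mathfrak p}(x)=\prod_{i=1}^n\left(\frac{x-p_i^+}{x-p_i^-}\chi_{\{x>0\}}+\frac{x-p_i^-}{x-p_i^+}\chi_{\{x<0\}}\right),$$ and identify it with the corresponding multiplication operator. For a kernel $K$ on $\mathbb{R}^*\times\mathbb{R}^*$ and $q\in\mathbb{R}^*$ put $$K^q(x,y)=K(x,y)-\frac{K(x,q)K(q,y)}{K(q,q)}\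 \text{ if } K(q,q)\ne 0,\qquad K^q=K\ \text{ if } K(q,q)=0,$$ and $K^{(q_1,\dots,q_k)}=(\cdots(K^{q_1})^{q_2}\cdots)^{q_k}$. Then $1+L$ and $1+g_{\mathfrak p}Lg_{\mathfrak p}$ are invertible; the operators $K_L:=L(1+L)^{-1}$ and $K_{g_{\mathfrak p}Lg_{\mathfrak p}}:=g_{\mathfrak p}Lg_{\mathfrak p}(1+g_{\mathfrak p}Lg_{\mathfrak p})^{-1}$ have integral kernels that are continuous on $\mathbb{R}^*\times\mathbb{R}^*$; and for these continuous kernels $$K_L^{\mathfrak p}(x,y)=K_{g_{\mathfrak p}Lg_{\mathfrak p}}(x,y)\qquad\text{for all }x,y\in\mathbb{R}^*,$$ whatever the order in which the $2n$ points are used in the iteration defining $K_L^{\mathfrak p}$. In particular, for $n=1$, $K_L^{(p^+,p^-)}=K_{g_{\mathfrak p}Lg_{\mathfrak p}}$. -/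

import Mathlib

open MeasureTheory Set
open scoped ENNReal

noncomputable section

namespace PalmKernel

/-- The Hilbert space `L²(ℝ*, dx)` of complex-valued functions. The origin is Lebesgue-null, so it
is the same as `L²(ℝ, dx)`. -/
abbrev H : Type := Lp ℂ 2 (volume : Measure ℝ)

/-- `K` is an integral kernel of the bounded operator `T`: for every `f ∈ L²`,
`(T f)(x) = ∫ K(x,y) f(y) dy` for almost every `x`, the integral being absolutely convergent. -/
def IsIntegralKernel (K : ℝ → ℝ → ℂ) (T : H →L[ℂ] H) : Prop :=
  ∀ f : H, ∀ᵐ x : ℝ, Integrable (fun y => K x y * f y) ∧ (T f) x = ∫ y, K x y * f y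

/-- `K` is the continuous integral kernel of `T` on `ℝ* × ℝ*`. Its values at the points of
`ℝ* × ℝ*` are determined by `T`; values with a zero coordinate are irrelevant. -/
def IsContinuousKernel (K : ℝ → ℝ → ℂ) (T : H →L[ℂ] H) : Prop :=
  ContinuousOn (fun z : ℝ × ℝ => K z.1 z.2) ({0}ᶜ ×ˢ {0}ᶜ) ∧ IsIntegralKernel K T

/-- `A⁺ = A χ_{(0,∞)}`. -/
def posPart (A : ℝ → ℝ) : ℝ → ℝ := (Ioi 0).indicator A

/-- `A⁻ = A χ_{(-∞,0)}`. -/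
def negPart (A : ℝ → ℝ) : ℝ → ℝ := (Iio 0).indicator A

/-- The bounded operator `L` on `L²(ℝ*)` has the integral kernel
`(A⁺(x) A⁻(y) + A⁻(x) A⁺(y)) / (x - y)`, where `A` is a real function of class `C¹` on `ℝ*`,
square integrable, and whose (closed) support in `ℝ*` is all of `ℝ*`. -/
structure IsAdmissible (L : H →L[ℂ] H) (A : ℝ → ℝ) : Prop where
  contDiffOn : ContDiffOn ℝ 1 A {0}ᶜ
  memLp : MemLp A 2 (volume : Measure ℝ)
  fullSupport : ({0}ᶜ : Set ℝ) ⊆ closure (Function.support A)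
  kernel : IsIntegralKernel
    (fun x y => (((posPart A x * negPart A y + negPart A x * posPart A y) / (x - y) : ℝ) : ℂ)) L

/-- `K_L = L (1 + L)⁻¹` (meaningful when `1 + L` is invertible). -/
def KOp (L : H →L[ℂ] H) : H →L[ℂ] H := L * Ring.inverse (1 + L)

/-- One step of the Palm reduction: `K^q(x,y) = K(x,y) - K(x,q) K(q,y) / K(q,q)` if
`K(q,q) ≠ 0`, and `K^q = K` otherwise. -/
def palmStep (K : ℝ → ℝ → ℂ) (q : ℝ) : ℝ → ℝ → ℂ :=
  if K q q = 0 then K else fun x y => K x y - K x q * K q y / K q q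

/-- The iterated Palm kernel `K^{(q₁,…,q_k)} = (⋯(K^{q₁})^{q₂}⋯)^{q_k}`. -/
def palmKernel (K : ℝ → ℝ → ℂ) (q : List ℝ) : ℝ → ℝ → ℂ := q.foldl palmStep K

/-- The weight
`g_𝔭(x) = ∏ᵢ ((x - pᵢ⁺)/(x - pᵢ⁻) χ_{x > 0} + (x - pᵢ⁻)/(x - pᵢ⁺) χ_{x < 0})`. -/
def weight {n : ℕ} (pp pm : Fin n → ℝ) (x : ℝ) : ℝ :=
  ∏ i, ((Ioi 0).indicator (fun x => (x - pp i) / (x - pm i)) x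
    + (Iio 0).indicator (fun x => (x - pm i) / (x - pp i)) x)

/-- Multiplication by an essentially bounded function, as a bounded operator on `L²`. -/
def mulOp (g : ℝ → ℝ) (hg : MemLp (fun x => (g x : ℂ)) ∞ (volume : Measure ℝ)) : H →L[ℂ] H :=
  (ContinuousLinearMap.mul ℂ ℂ).holderL volume ∞ 2 2 hg.toLp

theorem abs_div_sub_le {x a b : ℝ} (hx : 0 < x) (ha : 0 < a) (hb : b < 0) :
    |(x - a) / (x - b)| ≤ 1 + a / (-b) := by
  have h1 : 0 < x - b := by linarith
  have h2 : 0 < -b := by linarith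
  have h3 : 0 ≤ a / (-b) := (div_pos ha h2).le
  have h4 : a / (-b) * (-b) = a := div_mul_cancel₀ a h2.ne'
  rw [abs_div, abs_of_pos h1, div_le_iff₀ h1, abs_le]
  constructor <;> nlinarith [mul_nonneg h3 hx.le]

theorem weight_memLp {n : ℕ} {pp pm : Fin n → ℝ} (hpp : ∀ i, 0 < pp i) (hpm : ∀ i, pm i < 0) :
    MemLp (fun x => (weight pp pm x : ℂ)) ∞ (volume : Measure ℝ) := by
  have hm : Measurable (weight pp pm) := by
    unfold weight
    refine Finset.measurable_prod _ fun i _ => ?_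
    refine (Measurable.indicator ?_ measurableSet_Ioi).add
      (Measurable.indicator ?_ measurableSet_Iio) <;> fun_prop
  refine memLp_top_of_bound (Complex.measurable_ofReal.comp hm).aestronglyMeasurable
    (∏ i, ((1 + pp i / (-pm i)) + (1 + (-pm i) / pp i))) (Filter.Eventually.of_forall fun x => ?_)
  rw [Complex.norm_real, Real.norm_eq_abs, weight, Finset.abs_prod]
  refine Finset.prod_le_prod (fun i _ => abs_nonneg _) fun i _ => ?_
  have h1 : 0 < pp i / (-pm i) := div_pos (hpp i) (neg_pos.2 (hpm i))
  have h2 : 0 < (-pm i) / pp i := div_pos (neg_pos.2 (hpm i)) (hpp i)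
  rcases lt_trichotomy x 0 with hx | rfl | hx
  · have h := abs_div_sub_le (neg_pos.2 hx) (neg_pos.2 (hpm i)) (neg_lt_zero.2 (hpp i))
    have e : (-x - -pm i) / (-x - -pp i) = (x - pm i) / (x - pp i) := by
      rw [← neg_div_neg_eq]; congr 1 <;> ring
    rw [e, neg_neg] at h
    simp only [indicator, mem_Ioi, mem_Iio, hx, hx.not_gt, if_true, if_false, zero_add]
    linarith
  · simp only [indicator, mem_Ioi, mem_Iio, lt_irrefl, if_false, add_zero, abs_zero]
    linarith
  · have h := abs_div_sub_le hx (hpp i) (hpm i)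
    simp only [indicator, mem_Ioi, mem_Iio, hx, hx.not_gt, if_true, if_false, add_zero]
    linarith

/-- The operator `g_𝔭 L g_𝔭`. -/
def weightConj {n : ℕ} (pp pm : Fin n → ℝ) (hpp : ∀ i, 0 < pp i) (hpm : ∀ i, pm i < 0)
    (L : H →L[ℂ] H) : H →L[ℂ] H :=
  mulOp (weight pp pm) (weight_memLp hpp hpm) * L * mulOp (weight pp pm) (weight_memLp hpp hpm)

end PalmKernel

end

/-!
The kernel of `L` is real and antisymmetric, so `L` is skew-adjoint and `1 + L` is invertible, and
`K = K_L` satisfies `K + K* = 2 R* R` with `R = (1 + L)⁻¹`. Thus `K p q + conj (K q p)` is twice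
the Gram matrix of the vectors `R r_q`, where `r_q` is the row of `L` at `q`. The rows at the points
of `𝔭` are linearly independent, so every principal submatrix of `K` on `𝔭` is nonsingular. Hence
the Palm reduction, in whatever order, produces the unique function in
`K(x, ·) + span {K(q, ·) | q ∈ 𝔭}` that vanishes on `𝔭`.

The row of `K_{gLg}` at `x` has the same two properties. It vanishes on `𝔭` because `g` does. A
partial fraction expansion of `g(x) g(y) / (x - y)` shows that the rows of `gLg` differ from those
of `L` by combinations of the rows `r_q` with `q ∈ 𝔭`; so `gLg` and `L` agree on the orthogonal
complement of these rows, and the resolvent identity carries the difference over to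
`span {K(q, ·) | q ∈ 𝔭}`.
-/

namespace PalmKernel

open scoped InnerProductSpace ComplexConjugate

noncomputable section

/-- Every finite principal submatrix of `K` with indices in `S` is nonsingular. -/
def IsPrincipallyNonsingular (K : ℝ → ℝ → ℂ) (S : Set ℝ) : Prop :=
  ∀ T : Finset ℝ, ↑T ⊆ S → ∀ c : ℝ → ℂ,
    (∀ q ∈ T, ∑ p ∈ T, c p * K p q = 0) → ∀ p ∈ T, c p = 0

theorem IsPrincipallyNonsingular.mono {K : ℝ → ℝ → ℂ} {S S' : Set ℝ}
    (h : IsPrincipallyNonsingular K S') (hS : S ⊆ S') : IsPrincipallyNonsingular K S :=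
  fun T hT => h T (hT.trans hS)

theorem IsPrincipallyNonsingular.linearIndepOn {K : ℝ → ℝ → ℂ} {S : Set ℝ}
    (h : IsPrincipallyNonsingular K S) : LinearIndepOn ℂ K S := by
  rw [linearIndepOn_iff']
  intro T c hT hc
  refine h T hT c fun q _ => ?_
  simpa using congrFun hc q

theorem IsPrincipallyNonsingular.eq_zero_of_mem_span {K : ℝ → ℝ → ℂ} {S : Set ℝ}
    (hK : IsPrincipallyNonsingular K S) {f : ℝ → ℂ} (hf : f ∈ Submodule.span ℂ (K '' S))
    (hfS : ∀ q ∈ S, f q = 0) : f = 0 := by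
  obtain ⟨c, hc, rfl⟩ := (Finsupp.mem_span_image_iff_linearCombination ℂ).1 hf
  have hc0 := hK c.support hc c fun q hq => by
    simpa [Finsupp.linearCombination_apply, Finsupp.sum] using hfS q (hc hq)
  rw [Finsupp.linearCombination_apply, Finsupp.sum]
  exact Finset.sum_eq_zero fun p hp => by simp only [hc0 p hp, zero_smul]

theorem isPrincipallyNonsingular_of_add_conj_eq_inner {E : Type*} [NormedAddCommGroup E]
    [InnerProductSpace ℂ E] {K : ℝ → ℝ → ℂ} {S : Set ℝ} {v : ℝ → E}
    (hK : ∀ p ∈ S, ∀ q ∈ S, K p q + conj (K q p) = 2 * ⟪v p, v q⟫_ℂ)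
    (hv : LinearIndepOn ℂ v S) : IsPrincipallyNonsingular K S := by
  intro T hT c hc
  set w : E := ∑ p ∈ T, conj (c p) • v p
  have hw : 2 * ⟪w, w⟫_ℂ = 0 := calc
    2 * ⟪w, w⟫_ℂ = ∑ p ∈ T, ∑ q ∈ T, c p * conj (c q) * (K p q + conj (K q p)) := by
        simp only [w, sum_inner, inner_sum, inner_smul_left, inner_smul_right, Complex.conj_conj,
          Finset.mul_sum]
        refine Finset.sum_comm.trans (Finset.sum_congr rfl fun p hp =>
          Finset.sum_congr rfl fun q hq => ?_)
        rw [hK p (hT hp) q (hT hq)]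
        ring
    _ = ∑ q ∈ T, conj (c q) * ∑ p ∈ T, c p * K p q +
        ∑ p ∈ T, c p * conj (∑ q ∈ T, c q * K q p) := by
        simp only [map_sum, map_mul, Finset.mul_sum, mul_add, Finset.sum_add_distrib]
        congr 1
        · refine Finset.sum_comm.trans (Finset.sum_congr rfl fun q _ =>
            Finset.sum_congr rfl fun p _ => ?_)
          ring
        · exact Finset.sum_congr rfl fun p _ => Finset.sum_congr rfl fun q _ => by ring
    _ = 0 := by
        rw [Finset.sum_eq_zero fun q hq => by rw [hc q hq, mul_zero],
          Finset.sum_eq_zero fun p hp => by rw [hc p hp, map_zero, mul_zero], add_zero]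
  have hw0 : w = 0 := by simpa using hw
  have hc0 := linearIndepOn_iff'.1 hv T (fun p => conj (c p)) hT hw0
  exact fun p hp => (map_eq_zero _).1 (hc0 p hp)

theorem palmStep_sub_mem_span (K : ℝ → ℝ → ℂ) (q x : ℝ) :
    palmStep K q x - K x ∈ Submodule.span ℂ {K q} := by
  unfold palmStep
  split_ifs with h
  · simp
  · refine Submodule.mem_span_singleton.2 ⟨-(K x q / K q q), ?_⟩
    ext y
    simp only [Pi.smul_apply, Pi.sub_apply, smul_eq_mul]
    ring

theorem palmStep_apply_self {K : ℝ → ℝ → ℂ} {q : ℝ} (hq : K q q ≠ 0) (x : ℝ) :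
    palmStep K q x q = 0 := by
  simp [palmStep, hq]

theorem palmStep_apply_of_forall_eq_zero {K : ℝ → ℝ → ℂ} {p : ℝ} (hp : ∀ x, K x p = 0)
    (q x : ℝ) : palmStep K q x p = 0 := by
  unfold palmStep
  split_ifs <;> simp [hp]

theorem palmKernel_concat (K : ℝ → ℝ → ℂ) (l : List ℝ) (q : ℝ) :
    palmKernel K (l ++ [q]) = palmStep (palmKernel K l) q := by
  simp [palmKernel]

theorem palmKernel_sub_mem_span (K : ℝ → ℝ → ℂ) (l : List ℝ) (x : ℝ) :
    palmKernel K l x - K x ∈ Submodule.span ℂ (K '' {q | q ∈ l}) := by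
  induction l using List.reverseRecOn generalizing x with
  | nil => simp [palmKernel]
  | append_singleton l q ih =>
    set V := Submodule.span ℂ (K '' {p | p ∈ l ++ [q]})
    have hl : ∀ x, palmKernel K l x - K x ∈ V := fun x =>
      Submodule.span_mono (image_mono fun p hp => List.mem_append_left _ hp) (ih x)
    have hKq : K q ∈ V := Submodule.subset_span (mem_image_of_mem K (by simp))
    have hq : palmKernel K l q ∈ V := by simpa using V.add_mem (hl q) hKq
    have hstep : palmStep (palmKernel K l) q x - palmKernel K l x ∈ V :=
      (Submodule.span_singleton_le_iff_mem _ _).2 hq (palmStep_sub_mem_span _ q x)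
    rw [palmKernel_concat]
    simpa using V.add_mem hstep (hl x)

theorem palmKernel_apply_self_ne_zero {K : ℝ → ℝ → ℂ} {l : List ℝ} {q : ℝ} (hq : q ∉ l)
    (hK : IsPrincipallyNonsingular K {p | p ∈ l ++ [q]})
    (hl : ∀ p ∈ l, palmKernel K l q p = 0) : palmKernel K l q q ≠ 0 := by
  intro hqq
  have hins : {p | p ∈ l ++ [q]} = insert q {p | p ∈ l} := by
    ext p
    simp only [List.mem_append, List.mem_singleton, mem_ofPred_eq, mem_insert_iff, or_comm]
  rw [hins] at hK
  have hmem := palmKernel_sub_mem_span K l q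
  have hspan : palmKernel K l q ∈ Submodule.span ℂ (K '' insert q {p | p ∈ l}) := by
    rw [← sub_add_cancel (palmKernel K l q) (K q)]
    exact add_mem (Submodule.span_mono (image_mono (subset_insert _ _)) hmem)
      (Submodule.subset_span (mem_image_of_mem K (mem_insert _ _)))
  have hzero : palmKernel K l q = 0 := hK.eq_zero_of_mem_span hspan fun p hp =>
    hp.elim (fun hp => by rwa [hp]) (hl p)
  rw [hzero, zero_sub, neg_mem_iff] at hmem
  exact ((linearIndepOn_insert (s := {p | p ∈ l}) hq).1 hK.linearIndepOn).2 hmem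

theorem palmKernel_apply_eq_zero {K : ℝ → ℝ → ℂ} {l : List ℝ} (hl : l.Nodup)
    (hK : IsPrincipallyNonsingular K {q | q ∈ l}) (x : ℝ) {p : ℝ} (hp : p ∈ l) :
    palmKernel K l x p = 0 := by
  induction l using List.reverseRecOn generalizing x p with
  | nil => simp at hp
  | append_singleton l q ih =>
    have hql : q ∉ l := fun h =>
      (List.nodup_append.1 hl).2.2 q h q (List.mem_singleton_self q) rfl
    have hsub : {p | p ∈ l} ⊆ {p | p ∈ l ++ [q]} := fun p => List.mem_append_left _
    replace ih := ih (hl.sublist (List.sublist_append_left l [q])) (hK.mono hsub)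
    have hdiag : palmKernel K l q q ≠ 0 :=
      palmKernel_apply_self_ne_zero hql hK fun p hp => ih q hp
    rw [palmKernel_concat]
    rcases List.mem_append.1 hp with hp | hp
    · exact palmStep_apply_of_forall_eq_zero (fun x => ih x hp) q x
    · rw [List.mem_singleton.1 hp]
      exact palmStep_apply_self hdiag x

theorem palmKernel_eq_add_of_mem_span {K : ℝ → ℝ → ℂ} {l : List ℝ} (hl : l.Nodup)
    (hK : IsPrincipallyNonsingular K {q | q ∈ l}) {x : ℝ} {f : ℝ → ℂ}
    (hf : f ∈ Submodule.span ℂ (K '' {q | q ∈ l})) (hfl : ∀ q ∈ l, K x q + f q = 0) :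
    palmKernel K l x = K x + f := by
  have hmem : palmKernel K l x - K x - f ∈ Submodule.span ℂ (K '' {q | q ∈ l}) :=
    sub_mem (palmKernel_sub_mem_span K l x) hf
  have hvanish : ∀ q ∈ l, (palmKernel K l x - K x - f) q = 0 := fun q hq => by
    simp only [Pi.sub_apply, palmKernel_apply_eq_zero hl hK x hq]
    linear_combination -hfl q hq
  have hzero := hK.eq_zero_of_mem_span hmem hvanish
  rwa [sub_sub, sub_eq_zero] at hzero

theorem isUnit_one_add_of_mem_skewAdjoint {B : Type*} [CStarAlgebra B] {a : B}
    (ha : a ∈ skewAdjoint B) : IsUnit (1 + a) := by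
  have hsa : IsSelfAdjoint (Complex.I • a) := by
    rw [isSelfAdjoint_iff, star_smul, skewAdjoint.mem_iff.1 ha]
    simp
  have hspec : -Complex.I ∉ spectrum ℂ (Complex.I • a) := fun h => by
    simpa using hsa.im_eq_zero_of_mem_spectrum h
  have hfactor : algebraMap ℂ B (-Complex.I) - Complex.I • a = -Complex.I • (1 + a) := by
    rw [Algebra.algebraMap_eq_smul_one, smul_add, neg_smul, neg_smul, sub_eq_add_neg]
  rw [spectrum.notMem_iff, hfactor] at hspec
  have hI : IsUnit (-Complex.I) := by simp
  exact (isUnit_smul_iff hI.unit (1 + a)).1 hspec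

theorem isUnit_one_sub_of_mem_skewAdjoint {B : Type*} [CStarAlgebra B] {a : B}
    (ha : a ∈ skewAdjoint B) : IsUnit (1 - a) := by
  rw [sub_eq_add_neg]
  exact isUnit_one_add_of_mem_skewAdjoint (neg_mem ha)

section HilbertSpace

variable {E : Type*} [NormedAddCommGroup E] [InnerProductSpace ℂ E] [CompleteSpace E]
  {L L' : E →L[ℂ] E}

theorem inner_apply_left_of_mem_skewAdjoint (hL : L ∈ skewAdjoint (E →L[ℂ] E)) (f g : E) :
    ⟪L f, g⟫_ℂ = -⟪f, L g⟫_ℂ := by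
  rw [← ContinuousLinearMap.adjoint_inner_right, ← ContinuousLinearMap.star_eq_adjoint,
    skewAdjoint.mem_iff.1 hL, neg_apply, inner_neg_right]

theorem inner_inverse_one_sub_left (hL : L ∈ skewAdjoint (E →L[ℂ] E)) (f g : E) :
    ⟪Ring.inverse (1 - L) f, g⟫_ℂ = ⟪f, Ring.inverse (1 + L) g⟫_ℂ := by
  rw [← ContinuousLinearMap.adjoint_inner_right, ← ContinuousLinearMap.star_eq_adjoint,
    ← Ring.inverse_star, star_sub, star_one, skewAdjoint.mem_iff.1 hL, sub_neg_eq_add]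

theorem inverse_one_add_apply_add (hL : L ∈ skewAdjoint (E →L[ℂ] E)) (f : E) :
    Ring.inverse (1 + L) f + L (Ring.inverse (1 + L) f) = f :=
  DFunLike.congr_fun (Ring.mul_inverse_cancel _ (isUnit_one_add_of_mem_skewAdjoint hL)) f

theorem inverse_one_sub_apply_sub (hL : L ∈ skewAdjoint (E →L[ℂ] E)) (f : E) :
    Ring.inverse (1 - L) f - L (Ring.inverse (1 - L) f) = f :=
  DFunLike.congr_fun (Ring.mul_inverse_cancel _ (isUnit_one_sub_of_mem_skewAdjoint hL)) f

theorem inverse_one_sub_apply_sub_self (hL : L ∈ skewAdjoint (E →L[ℂ] E)) (f : E) :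
    Ring.inverse (1 - L) (f - L f) = f :=
  DFunLike.congr_fun (Ring.inverse_mul_cancel _ (isUnit_one_sub_of_mem_skewAdjoint hL)) f

theorem inner_inverse_one_add_add_inner (hL : L ∈ skewAdjoint (E →L[ℂ] E)) (f g : E) :
    ⟪f, Ring.inverse (1 + L) g⟫_ℂ + ⟪Ring.inverse (1 + L) f, g⟫_ℂ =
      2 * ⟪Ring.inverse (1 + L) f, Ring.inverse (1 + L) g⟫_ℂ := by
  set u := Ring.inverse (1 + L) f with hu
  set v := Ring.inverse (1 + L) g with hv
  rw [← inverse_one_add_apply_add hL f, ← inverse_one_add_apply_add hL g, ← hu, ← hv,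
    inner_add_left, inner_add_right, inner_apply_left_of_mem_skewAdjoint hL]
  ring

theorem sub_apply_mem_of_eqOn_orthogonal (hL : L ∈ skewAdjoint (E →L[ℂ] E))
    (hL' : L' ∈ skewAdjoint (E →L[ℂ] E)) {V : Submodule ℂ E} [V.HasOrthogonalProjection]
    (hV : EqOn L' L Vᗮ) (f : E) : L' f - L f ∈ V := by
  rw [← V.orthogonal_orthogonal, Submodule.mem_orthogonal]
  intro g hg
  rw [inner_sub_right, sub_eq_zero, ← neg_inj, ← inner_apply_left_of_mem_skewAdjoint hL',
    ← inner_apply_left_of_mem_skewAdjoint hL, hV hg]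

theorem inverse_apply_sub_inverse_apply_mem_map (hL : L ∈ skewAdjoint (E →L[ℂ] E))
    (hL' : L' ∈ skewAdjoint (E →L[ℂ] E)) {V : Submodule ℂ E} [V.HasOrthogonalProjection]
    (hV : EqOn L' L Vᗮ) {f f' : E} (hf : f' - f ∈ V) :
    Ring.inverse (1 - L') f' - Ring.inverse (1 - L) f ∈
      V.map (Ring.inverse (1 - L) : E →L[ℂ] E).toLinearMap := by
  set s := Ring.inverse (1 - L') f'
  have hmem : s - L s - f ∈ V := by
    have hs : s - L s - f = f' - f + (L' s - L s) := by
      rw [← inverse_one_sub_apply_sub hL' f']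
      abel
    rw [hs]
    exact add_mem hf (sub_apply_mem_of_eqOn_orthogonal hL hL' hV s)
  refine ⟨_, hmem, ?_⟩
  rw [ContinuousLinearMap.coe_coe, map_sub, inverse_one_sub_apply_sub_self hL]

end HilbertSpace

theorem isIntegralKernel_iff_ae_eq_inner {K : ℝ → ℝ → ℂ} {v : ℝ → H}
    (hv : ∀ x, (fun y => conj (v x y)) =ᵐ[volume] K x) {T : H →L[ℂ] H} :
    IsIntegralKernel K T ↔ ∀ f : H, ∀ᵐ x, T f x = ⟪v x, f⟫_ℂ := by
  have hinner (x : ℝ) (f : H) : (fun y => ⟪v x y, f y⟫_ℂ) =ᵐ[volume] fun y => K x y * f y := by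
    filter_upwards [hv x] with y hy
    rw [← hy, RCLike.inner_apply, mul_comm]
  refine forall_congr' fun f => Filter.eventually_congr (Filter.Eventually.of_forall fun x => ?_)
  rw [L2.inner_def, integral_congr_ae (hinner x f),
    and_iff_right ((L2.integrable_inner (v x) f).congr (hinner x f))]

theorem IsIntegralKernel.ae_setIntegral_sub_eq_zero {K K' : ℝ → ℝ → ℂ} {T : H →L[ℂ] H}
    (hK : IsIntegralKernel K T) (hK' : IsIntegralKernel K' T) {V : Set ℝ}
    (hV : MeasurableSet V) (hVfin : volume V ≠ ∞) :
    ∀ᵐ x, IntegrableOn (fun y => K x y - K' x y) V ∧ ∫ y in V, (K x y - K' x y) = 0 := by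
  set f : H := indicatorConstLp 2 hV hVfin (1 : ℂ)
  filter_upwards [hK f, hK' f] with x ⟨hi, he⟩ ⟨hi', he'⟩
  have hindicator : (fun y => K x y * f y - K' x y * f y) =ᵐ[volume]
      V.indicator fun y => K x y - K' x y := by
    filter_upwards [indicatorConstLp_coeFn (p := 2) (hs := hV) (hμs := hVfin) (c := (1 : ℂ))]
      with y hy
    by_cases hyV : y ∈ V <;> simp [f, hy, hyV]
  constructor
  · exact (integrable_indicator_iff hV).1 ((hi.sub hi').congr hindicator)
  · rw [← integral_indicator hV, ← integral_congr_ae hindicator, integral_sub hi hi', ← he, ← he',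
      sub_self]

theorem IsContinuousKernel.unique {K K' : ℝ → ℝ → ℂ} {T : H →L[ℂ] H}
    (hK : IsContinuousKernel K T) (hK' : IsContinuousKernel K' T) {x y : ℝ}
    (hx : x ≠ 0) (hy : y ≠ 0) : K x y = K' x y := by
  by_contra hne
  set a : ℂ := K x y - K' x y
  have ha : a ≠ 0 := sub_ne_zero.2 hne
  -- Near `(x, y)` the difference of the kernels points into the half-plane around `a`, so it
  -- cannot average to zero over small intervals.
  have hpos : ∀ᶠ z : ℝ × ℝ in nhds (x, y), 0 < (conj a * (K z.1 z.2 - K' z.1 z.2)).re := by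
    have hopen : IsOpen (({0}ᶜ : Set ℝ) ×ˢ ({0}ᶜ : Set ℝ)) :=
      isOpen_compl_singleton.prod isOpen_compl_singleton
    have hcont : ContinuousAt (fun z : ℝ × ℝ => (conj a * (K z.1 z.2 - K' z.1 z.2)).re) (x, y) :=
      Complex.continuous_re.continuousAt.comp (continuousAt_const.mul
        ((hK.1.sub hK'.1).continuousAt (hopen.mem_nhds ⟨hx, hy⟩)))
    refine hcont.eventually (lt_mem_nhds ?_)
    change 0 < (conj a * a).re
    rw [← Complex.normSq_eq_conj_mul_self, Complex.ofReal_re]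
    exact Complex.normSq_pos.2 ha
  obtain ⟨r, hr, hball⟩ := Metric.eventually_nhds_iff_ball.1 hpos
  rw [← ball_prod_same] at hball
  obtain ⟨x', hx', hint, hzero⟩ := Measure.exists_mem_of_measure_ne_zero_of_ae
    (Metric.measure_ball_pos volume x hr).ne' (ae_restrict_of_ae
      (hK.2.ae_setIntegral_sub_eq_zero hK'.2 (measurableSet_ball (x := y) (ε := r))
        measure_ball_lt_top.ne))
  have hre : ∫ z in Metric.ball y r, (conj a * (K x' z - K' x' z)).re = 0 := by
    rw [← RCLike.re_eq_complex_re, integral_re (hint.const_mul _), integral_const_mul, hzero]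
    simp
  refine hre.not_gt ((setIntegral_pos_iff_support_of_nonneg_ae ?_ (hint.const_mul _).re).2 ?_)
  · exact ae_restrict_of_forall_mem measurableSet_ball fun z hz => (hball (x', z) ⟨hx', hz⟩).le
  · exact (Metric.measure_ball_pos volume y hr).trans_le (measure_mono (subset_inter
      (fun z hz => (hball (x', z) ⟨hx', hz⟩).ne') subset_rfl))

theorem IsIntegralKernel.inner_apply_eq_neg {K : ℝ → ℝ → ℂ} {T : H →L[ℂ] H}
    (hK : IsIntegralKernel K T) (hskew : ∀ x y, K y x = -conj (K x y)) {f g : H}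
    (hint : Integrable (fun z : ℝ × ℝ => conj (g z.1) * (K z.1 z.2 * f z.2))
      ((volume : Measure ℝ).prod volume)) :
    ⟪g, T f⟫_ℂ = -⟪T g, f⟫_ℂ := by
  have hleft : ⟪g, T f⟫_ℂ = ∫ x, ∫ y, conj (g x) * (K x y * f y) := by
    rw [L2.inner_def]
    refine integral_congr_ae ?_
    filter_upwards [hK f] with x ⟨_, hx⟩
    rw [RCLike.inner_apply, hx, mul_comm, integral_const_mul]
  have hright : -⟪T g, f⟫_ℂ = ∫ y, ∫ x, conj (g x) * (K x y * f y) := by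
    rw [L2.inner_def, ← integral_neg]
    refine integral_congr_ae ?_
    filter_upwards [hK g] with y ⟨_, hy⟩
    rw [RCLike.inner_apply, hy, ← integral_conj, ← integral_const_mul, ← integral_neg]
    refine integral_congr_ae (Filter.Eventually.of_forall fun x => ?_)
    simp only [hskew x y, map_mul, map_neg, Complex.conj_conj]
    ring
  rw [hleft, hright, integral_integral_swap hint]

theorem ae_eq_zero_of_forall_inner_eq_zero {α : Type*} [MeasurableSpace α] {μ : Measure α}
    {w : Lp ℂ 2 μ} {S : Set α} (hS : MeasurableSet S)
    (hw : ∀ f : Lp ℂ 2 μ, (∀ᵐ y ∂μ, y ∉ S → f y = 0) → ⟪w, f⟫_ℂ = 0) :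
    ∀ᵐ y ∂μ, y ∈ S → w y = 0 := by
  set f : Lp ℂ 2 μ := ((Lp.memLp w).indicator hS).toLp
  have hf : (f : α → ℂ) =ᵐ[μ] S.indicator w := MemLp.coeFn_toLp _
  have hff : ⟪f, f⟫_ℂ = ⟪w, f⟫_ℂ := by
    rw [L2.inner_def, L2.inner_def]
    refine integral_congr_ae ?_
    filter_upwards [hf] with y hy
    by_cases hyS : y ∈ S <;> simp [hy, hyS]
  have hwf : ⟪w, f⟫_ℂ = 0 := hw f <| by
    filter_upwards [hf] with y hy hyS
    rw [hy, indicator_of_notMem hyS]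
  have hf0 : f = 0 := inner_self_eq_zero.1 (hff.trans hwf)
  filter_upwards [hf, Lp.eq_zero_iff_ae_eq_zero.1 hf0] with y hy hy0 hyS
  rw [← indicator_of_mem hyS w, ← hy, hy0, Pi.zero_apply]

/-- The kernel `(A⁺(x) A⁻(y) + A⁻(x) A⁺(y)) / (x - y)` of the operators under consideration. -/
def cauchyKernel (A : ℝ → ℝ) (x y : ℝ) : ℝ :=
  (posPart A x * negPart A y + negPart A x * posPart A y) / (x - y)

theorem cauchyKernel_swap (A : ℝ → ℝ) (x y : ℝ) : cauchyKernel A y x = -cauchyKernel A x y := by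
  rw [cauchyKernel, cauchyKernel, ← neg_sub x y, div_neg]
  ring

theorem cauchyKernel_of_mul_neg (A : ℝ → ℝ) {x y : ℝ} (hxy : x * y < 0) :
    cauchyKernel A x y = A x * A y / (x - y) := by
  rcases mul_neg_iff.1 hxy with ⟨hx, hy⟩ | ⟨hx, hy⟩ <;>
    simp [cauchyKernel, posPart, negPart, hx, hy, hx.le, hy.le]

theorem cauchyKernel_of_mul_nonneg (A : ℝ → ℝ) {x y : ℝ} (hxy : 0 ≤ x * y) :
    cauchyKernel A x y = 0 := by
  rcases mul_nonneg_iff.1 hxy with ⟨hx, hy⟩ | ⟨hx, hy⟩ <;>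
    simp [cauchyKernel, posPart, negPart, indicator, hx.not_gt, hy.not_gt]

theorem cauchyKernel_ne_zero_iff {A : ℝ → ℝ} {x y : ℝ} :
    cauchyKernel A x y ≠ 0 ↔ x * y < 0 ∧ A x ≠ 0 ∧ A y ≠ 0 := by
  rcases lt_or_ge (x * y) 0 with hxy | hxy
  · have hne : x - y ≠ 0 := fun h => by
      rw [sub_eq_zero.1 h] at hxy
      exact (mul_self_nonneg y).not_gt hxy
    simp [cauchyKernel_of_mul_neg A hxy, hxy, hne]
  · simp [cauchyKernel_of_mul_nonneg A hxy, hxy.not_gt]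

theorem cauchyKernel_mul (g A : ℝ → ℝ) (x y : ℝ) :
    cauchyKernel (fun x => g x * A x) x y = g x * cauchyKernel A x y * g y := by
  rcases lt_or_ge (x * y) 0 with hxy | hxy
  · rw [cauchyKernel_of_mul_neg _ hxy, cauchyKernel_of_mul_neg _ hxy]
    ring
  · rw [cauchyKernel_of_mul_nonneg _ hxy, cauchyKernel_of_mul_nonneg _ hxy, mul_zero, zero_mul]

theorem mul_neg_iff_of_mul_pos {x z : ℝ} (hxz : 0 < x * z) (y : ℝ) : x * y < 0 ↔ z * y < 0 := by
  rcases mul_pos_iff.1 hxz with ⟨hx, hz⟩ | ⟨hx, hz⟩ <;>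
    simp [mul_neg_iff, hx, hz, hx.not_gt, hz.not_gt]

theorem abs_le_abs_sub_of_mul_nonpos {x y : ℝ} (hxy : x * y ≤ 0) : |x| ≤ |x - y| :=
  sq_le_sq.1 (by nlinarith [sq_nonneg y])

theorem abs_cauchyKernel_le (A : ℝ → ℝ) (x y : ℝ) :
    |cauchyKernel A x y| ≤ |A x| / |x| * |A y| := by
  rcases lt_or_ge (x * y) 0 with hxy | hxy
  · have hx : 0 < |x| := abs_pos.2 (left_ne_zero_of_mul hxy.ne)
    have hle := abs_le_abs_sub_of_mul_nonpos hxy.le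
    rw [cauchyKernel_of_mul_neg A hxy, abs_div, abs_mul, div_mul_eq_mul_div]
    gcongr
  · rw [cauchyKernel_of_mul_nonneg A hxy, abs_zero]
    positivity

theorem abs_cauchyKernel_sub_le (A : ℝ → ℝ) {x z : ℝ} (hzx : 0 < z * x) (y : ℝ) :
    |cauchyKernel A z y - cauchyKernel A x y| ≤
      (|A z - A x| / |x| + |A z| * |z - x| / (|z| * |x|)) * |A y| := by
  have hx : 0 < |x| := abs_pos.2 (right_ne_zero_of_mul hzx.ne')
  have hz : 0 < |z| := abs_pos.2 (left_ne_zero_of_mul hzx.ne')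
  rcases lt_or_ge (z * y) 0 with hzy | hzy
  · have hxy : x * y < 0 := (mul_neg_iff_of_mul_pos hzx y).1 hzy
    have hxle := abs_le_abs_sub_of_mul_nonpos hxy.le
    have hzle := abs_le_abs_sub_of_mul_nonpos hzy.le
    have hx0 : x - y ≠ 0 := abs_pos.1 (hx.trans_le hxle)
    have hz0 : z - y ≠ 0 := abs_pos.1 (hz.trans_le hzle)
    have hsub : A z * A y / (z - y) - A x * A y / (x - y) =
        ((A z - A x) / (x - y) + A z * (-(z - x)) / ((z - y) * (x - y))) * A y := by
      field_simp
      ring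
    rw [cauchyKernel_of_mul_neg A hzy, cauchyKernel_of_mul_neg A hxy, hsub, abs_mul]
    gcongr
    refine (abs_add_le _ _).trans ?_
    rw [abs_div, abs_div, abs_mul, abs_mul, abs_neg]
    gcongr
  · have hxy : 0 ≤ x * y := not_lt.1 (mt (mul_neg_iff_of_mul_pos hzx y).2 hzy.not_gt)
    rw [cauchyKernel_of_mul_nonneg A hzy, cauchyKernel_of_mul_nonneg A hxy, sub_zero, abs_zero]
    positivity

theorem continuousOn_cauchyKernel {A : ℝ → ℝ} (hA : ContinuousOn A {0}ᶜ) :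
    ContinuousOn (fun z : ℝ × ℝ => cauchyKernel A z.1 z.2) ({0}ᶜ ×ˢ {0}ᶜ) := by
  rintro ⟨x, y⟩ ⟨hx : x ≠ 0, hy : y ≠ 0⟩
  apply ContinuousAt.continuousWithinAt
  have hmul : ContinuousAt (fun z : ℝ × ℝ => z.1 * z.2) (x, y) := continuous_mul.continuousAt
  rcases (mul_ne_zero hx hy).lt_or_gt with hxy | hxy
  · have hAx : ContinuousAt A x := hA.continuousAt (isOpen_compl_singleton.mem_nhds hx)
    have hAy : ContinuousAt A y := hA.continuousAt (isOpen_compl_singleton.mem_nhds hy)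
    have hne : x - y ≠ 0 := fun h => by
      rw [sub_eq_zero.1 h] at hxy
      exact (mul_self_nonneg y).not_gt hxy
    have hquot : ContinuousAt (fun z : ℝ × ℝ => A z.1 * A z.2 / (z.1 - z.2)) (x, y) :=
      ((hAx.comp_of_eq continuousAt_fst rfl).mul (hAy.comp_of_eq continuousAt_snd rfl)).div
        (continuousAt_fst.sub continuousAt_snd) hne
    refine hquot.congr ?_
    filter_upwards [hmul.eventually (gt_mem_nhds hxy)] with z hz
    exact (cauchyKernel_of_mul_neg A hz).symm
  · refine (continuousAt_const (y := (0 : ℝ))).congr ?_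
    filter_upwards [hmul.eventually (lt_mem_nhds hxy)] with z hz
    exact (cauchyKernel_of_mul_nonneg A (le_of_lt hz)).symm

theorem aestronglyMeasurable_cauchyKernel {A : ℝ → ℝ} (hA : AEStronglyMeasurable A) :
    AEStronglyMeasurable (fun z : ℝ × ℝ => cauchyKernel A z.1 z.2)
      ((volume : Measure ℝ).prod volume) := by
  have hpos : AEStronglyMeasurable (posPart A) := hA.indicator measurableSet_Ioi
  have hneg : AEStronglyMeasurable (negPart A) := hA.indicator measurableSet_Iio
  exact ((hpos.comp_fst.mul hneg.comp_snd).add (hneg.comp_fst.mul hpos.comp_snd)).div₀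
    (continuous_fst.sub continuous_snd).aestronglyMeasurable

theorem aestronglyMeasurable_cauchyKernel_row {A : ℝ → ℝ} (hA : AEStronglyMeasurable A) (x : ℝ) :
    AEStronglyMeasurable (cauchyKernel A x) := by
  have hpos : AEStronglyMeasurable (posPart A) := hA.indicator measurableSet_Ioi
  have hneg : AEStronglyMeasurable (negPart A) := hA.indicator measurableSet_Iio
  exact ((hneg.const_mul _).add (hpos.const_mul _)).div₀
    (continuous_const.sub continuous_id).aestronglyMeasurable

theorem memLp_cauchyKernel_row {A : ℝ → ℝ} (hA : MemLp A 2 (volume : Measure ℝ)) (x : ℝ) :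
    MemLp (fun y => (cauchyKernel A x y : ℂ)) 2 (volume : Measure ℝ) :=
  (hA.of_le_mul (aestronglyMeasurable_cauchyKernel_row hA.1 x)
    (Filter.Eventually.of_forall (abs_cauchyKernel_le A x))).ofReal

section CauchyRow

variable {A : ℝ → ℝ} (hA : MemLp A 2 (volume : Measure ℝ))

/-- The row `y ↦ cauchyKernel A x y` as an element of `L²`. -/
def cauchyRow (x : ℝ) : H := (memLp_cauchyKernel_row hA x).toLp

theorem coeFn_cauchyRow (x : ℝ) :
    (cauchyRow hA x : ℝ → ℂ) =ᵐ[volume] fun y => (cauchyKernel A x y : ℂ) :=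
  MemLp.coeFn_toLp _

theorem conj_coeFn_cauchyRow (x : ℝ) :
    (fun y => conj (cauchyRow hA x y)) =ᵐ[volume] fun y => (cauchyKernel A x y : ℂ) := by
  filter_upwards [coeFn_cauchyRow hA x] with y hy
  rw [hy, Complex.conj_ofReal]

theorem coeFn_sum_smul_cauchyRow {ι : Type*} (s : Finset ι) (c : ι → ℂ) (p : ι → ℝ) :
    ((∑ i ∈ s, c i • cauchyRow hA (p i) : H) : ℝ → ℂ) =ᵐ[volume]
      fun y => ∑ i ∈ s, c i * (cauchyKernel A (p i) y : ℂ) := by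
  have hterm : ∀ᵐ y, ∀ i ∈ s, (c i • cauchyRow hA (p i) : H) y =
      c i * (cauchyKernel A (p i) y : ℂ) := by
    rw [Filter.eventually_all_finset]
    intro i _
    filter_upwards [Lp.coeFn_smul (c i) (cauchyRow hA (p i)), coeFn_cauchyRow hA (p i)]
      with y hsmul hrow
    rw [hsmul, Pi.smul_apply, hrow, smul_eq_mul]
  filter_upwards [hterm, Lp.coeFn_finsetSum s fun i => (c i • cauchyRow hA (p i) : H)]
    with y hterm hsum
  rw [hsum, Finset.sum_apply, Finset.sum_congr rfl hterm]

theorem norm_cauchyRow_sub_le {x z : ℝ} (hzx : 0 < z * x) :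
    ‖cauchyRow hA z - cauchyRow hA x‖ ≤ (|A z - A x| / |x| + |A z| * |z - x| / (|z| * |x|)) *
      ‖((hA.ofReal (K := ℂ)).toLp : H)‖ := by
  refine Lp.norm_le_mul_norm_of_ae_le_mul ?_
  filter_upwards [coeFn_cauchyRow hA z, coeFn_cauchyRow hA x, (hA.ofReal (K := ℂ)).coeFn_toLp,
    Lp.coeFn_sub (cauchyRow hA z) (cauchyRow hA x)] with y hz hx hAy hsub
  rw [hsub, Pi.sub_apply, hz, hx, hAy, ← Complex.ofReal_sub, Complex.norm_real]
  exact (abs_cauchyKernel_sub_le A hzx y).trans_eq (by simp)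

theorem continuousOn_cauchyRow (hc : ContinuousOn A {0}ᶜ) :
    ContinuousOn (cauchyRow hA) {0}ᶜ := by
  intro x (hx : x ≠ 0)
  apply ContinuousAt.continuousWithinAt
  have hAx : ContinuousAt A x := hc.continuousAt (isOpen_compl_singleton.mem_nhds hx)
  set a : ℝ := ‖((hA.ofReal (K := ℂ)).toLp : H)‖
  have hbound : Filter.Tendsto
      (fun z => (|A z - A x| / |x| + |A z| * |z - x| / (|z| * |x|)) * a) (nhds x) (nhds 0) := by
    have hcont : ContinuousAt
        (fun z => (|A z - A x| / |x| + |A z| * |z - x| / (|z| * |x|)) * a) x := by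
      have hden : |x| * |x| ≠ 0 := by positivity
      fun_prop (disch := assumption)
    simpa [ContinuousAt] using hcont
  have hnear : ∀ᶠ z in nhds x, 0 < z * x :=
    (continuousAt_id.mul continuousAt_const).eventually (lt_mem_nhds (mul_self_pos.2 hx))
  rw [ContinuousAt, tendsto_iff_norm_sub_tendsto_zero]
  exact squeeze_zero' (Filter.Eventually.of_forall fun _ => norm_nonneg _)
    (hnear.mono fun z hz => norm_cauchyRow_sub_le hA hz) hbound

end CauchyRow

/-- `L` is a bounded operator with kernel `cauchyKernel A`, where `A` is square integrable and
continuous on `ℝ*`. Unlike `IsAdmissible`, this property passes from `L` to `g L g` for every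
bounded `g` that is continuous on `ℝ*`. -/
structure IsCauchyOperator (L : H →L[ℂ] H) (A : ℝ → ℝ) : Prop where
  continuousOn : ContinuousOn A {0}ᶜ
  memLp : MemLp A 2 (volume : Measure ℝ)
  kernel : IsIntegralKernel (fun x y => (cauchyKernel A x y : ℂ)) L

namespace IsCauchyOperator

variable {L : H →L[ℂ] H} {A : ℝ → ℝ}

theorem ae_apply (h : IsCauchyOperator L A) (f : H) :
    ∀ᵐ x, L f x = ⟪cauchyRow h.memLp x, f⟫_ℂ :=
  (isIntegralKernel_iff_ae_eq_inner (conj_coeFn_cauchyRow h.memLp)).1 h.kernel f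

theorem inner_apply_eq_neg_of_vanishing (h : IsCauchyOperator L A) {ε : ℝ} (hε : 0 < ε) {f : H}
    (hf : ∀ᵐ y, |y| < ε → f y = 0) (g : H) : ⟪g, L f⟫_ℂ = -⟪L g, f⟫_ℂ := by
  refine h.kernel.inner_apply_eq_neg (fun x y => by
    rw [cauchyKernel_swap, Complex.conj_ofReal, Complex.ofReal_neg]) ?_
  have hAC : MemLp (fun x => (A x : ℂ)) 2 (volume : Measure ℝ) := h.memLp.ofReal
  have hAf : Integrable (fun y => (A y : ℂ) * f y) := hAC.integrable_mul (Lp.memLp f)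
  have hAg : Integrable (fun y => (A y : ℂ) * g y) := hAC.integrable_mul (Lp.memLp g)
  refine ((hAg.norm.mul_prod hAf.norm).const_mul ε⁻¹).mono' ?_ ?_
  · have hker := Complex.continuous_ofReal.comp_aestronglyMeasurable
      (aestronglyMeasurable_cauchyKernel h.memLp.1)
    have hg : AEStronglyMeasurable (fun x => conj (g x)) (volume : Measure ℝ) :=
      Complex.continuous_conj.comp_aestronglyMeasurable (Lp.aestronglyMeasurable g)
    exact hg.comp_fst.mul (hker.mul (Lp.aestronglyMeasurable f).comp_snd)
  · have hf' : ∀ᵐ z ∂((volume : Measure ℝ).prod volume), |z.2| < ε → f z.2 = 0 :=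
      Measure.quasiMeasurePreserving_snd.ae hf
    filter_upwards [hf'] with ⟨x, y⟩ hz
    simp only [norm_mul, RCLike.norm_conj, Complex.norm_real, Real.norm_eq_abs]
    rcases lt_or_ge |y| ε with hlt | hge
    · simp [hz hlt]
    · have hker : |cauchyKernel A x y| ≤ ε⁻¹ * |A y| * |A x| := by
        rw [cauchyKernel_swap, abs_neg]
        refine (abs_cauchyKernel_le A y x).trans ?_
        rw [div_eq_inv_mul]
        gcongr
      calc ‖g x‖ * (|cauchyKernel A x y| * ‖f y‖)
          ≤ ‖g x‖ * ((ε⁻¹ * |A y| * |A x|) * ‖f y‖) := by gcongr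
        _ = ε⁻¹ * (|A x| * ‖g x‖ * (|A y| * ‖f y‖)) := by ring

theorem mem_skewAdjoint (h : IsCauchyOperator L A) : L ∈ skewAdjoint (H →L[ℂ] H) := by
  rw [skewAdjoint.mem_iff, eq_neg_iff_add_eq_zero]
  ext1 g
  have hvanish : ∀ k : ℕ, ∀ᵐ y, y ∈ {y : ℝ | 1 / ((k : ℝ) + 1) ≤ |y|} →
      (star L + L) g y = 0 := fun k =>
    ae_eq_zero_of_forall_inner_eq_zero (measurableSet_le measurable_const measurable_norm)
      fun f hf => by
        rw [add_apply, inner_add_left, ContinuousLinearMap.star_eq_adjoint,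
          ContinuousLinearMap.adjoint_inner_left, h.inner_apply_eq_neg_of_vanishing
            (Nat.one_div_pos_of_nat (n := k)) (by simpa using hf), neg_add_cancel]
  refine (Lp.eq_zero_iff_ae_eq_zero).2 ?_
  filter_upwards [ae_all_iff.2 hvanish, Measure.ae_ne volume (0 : ℝ)] with y hy hy0
  obtain ⟨k, hk⟩ := exists_nat_one_div_lt (abs_pos.2 hy0)
  exact hy k hk.le

theorem isUnit_one_add (h : IsCauchyOperator L A) : IsUnit (1 + L) :=
  isUnit_one_add_of_mem_skewAdjoint h.mem_skewAdjoint

/-- The continuous integral kernel of `L (1 + L)⁻¹ = L - L (1 + L)⁻¹ L`. The inner product has a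
plus sign because the column of `L` at `y` is minus its row at `y`. -/
def resolventKernel (h : IsCauchyOperator L A) (x y : ℝ) : ℂ :=
  cauchyKernel A x y + ⟪cauchyRow h.memLp x, Ring.inverse (1 + L) (cauchyRow h.memLp y)⟫_ℂ

theorem conj_coeFn_inverse_cauchyRow (h : IsCauchyOperator L A) (x : ℝ) :
    (fun y => conj (Ring.inverse (1 - L) (cauchyRow h.memLp x) y)) =ᵐ[volume]
      h.resolventKernel x := by
  set s := Ring.inverse (1 - L) (cauchyRow h.memLp x) with hs
  have hfix : s = cauchyRow h.memLp x + L s :=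
    (sub_eq_iff_eq_add).1 (inverse_one_sub_apply_sub h.mem_skewAdjoint _)
  filter_upwards [conj_coeFn_cauchyRow h.memLp x, h.ae_apply s,
    Lp.coeFn_add (cauchyRow h.memLp x) (L s)] with y hrow hLs hadd
  rw [hfix, hadd, Pi.add_apply, map_add, hrow, hLs, inner_conj_symm, hs,
    inner_inverse_one_sub_left h.mem_skewAdjoint, resolventKernel]

theorem isContinuousKernel_resolventKernel (h : IsCauchyOperator L A) :
    IsContinuousKernel h.resolventKernel (KOp L) := by
  have hrow := continuousOn_cauchyRow h.memLp h.continuousOn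
  constructor
  · refine (Complex.continuous_ofReal.comp_continuousOn
      (continuousOn_cauchyKernel h.continuousOn)).add (ContinuousOn.inner (𝕜 := ℂ) ?_ ?_)
    · exact hrow.comp continuousOn_fst fun z hz => hz.1
    · exact (Ring.inverse (1 + L)).continuous.comp_continuousOn
        (hrow.comp continuousOn_snd fun z hz => hz.2)
  · refine (isIntegralKernel_iff_ae_eq_inner h.conj_coeFn_inverse_cauchyRow).2 fun f => ?_
    filter_upwards [h.ae_apply (Ring.inverse (1 + L) f)] with x hx
    rw [inner_inverse_one_sub_left h.mem_skewAdjoint, ← hx]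
    rfl

theorem resolventKernel_add_conj_swap (h : IsCauchyOperator L A) (x y : ℝ) :
    h.resolventKernel x y + conj (h.resolventKernel y x) =
      2 * ⟪Ring.inverse (1 + L) (cauchyRow h.memLp x),
        Ring.inverse (1 + L) (cauchyRow h.memLp y)⟫_ℂ := by
  rw [← inner_inverse_one_add_add_inner h.mem_skewAdjoint, resolventKernel, resolventKernel,
    map_add, Complex.conj_ofReal, inner_conj_symm, cauchyKernel_swap A x y, Complex.ofReal_neg]
  ring

end IsCauchyOperator

theorem eq_zero_of_sum_div_sub_eq_zero {ι F : Type*} [Field F] {s : Finset ι} {p : ι → F}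
    (hp : InjOn p s) {Z : Set F} (hZ : Z.Infinite) (hpZ : ∀ i ∈ s, p i ∉ Z) {a : ι → F}
    (ha : ∀ z ∈ Z, ∑ i ∈ s, a i / (p i - z) = 0) {i : ι} (hi : i ∈ s) : a i = 0 := by
  classical
  -- Clearing denominators gives a polynomial that vanishes on `Z`; its value at `p i` is a nonzero
  -- multiple of `a i`.
  set P : Polynomial F := ∑ j ∈ s, Polynomial.C (a j) *
    ∏ k ∈ s.erase j, (Polynomial.C (p k) - Polynomial.X)
  have heval (z : F) : P.eval z = ∑ j ∈ s, a j * ∏ k ∈ s.erase j, (p k - z) := by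
    simp [P, Polynomial.eval_finsetSum, Polynomial.eval_prod]
  have hP : P = 0 := by
    refine Polynomial.eq_zero_of_infinite_isRoot P (hZ.mono fun z hz => ?_)
    have hclear : P.eval z = (∏ k ∈ s, (p k - z)) * ∑ j ∈ s, a j / (p j - z) := by
      rw [heval, Finset.mul_sum]
      refine Finset.sum_congr rfl fun j hj => ?_
      have hne : p j - z ≠ 0 := sub_ne_zero.2 fun h => hpZ j hj (h ▸ hz)
      rw [← Finset.mul_prod_erase s _ hj]
      field_simp
    rw [mem_ofPred_eq, Polynomial.IsRoot, hclear, ha z hz, mul_zero]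
  have hPi := heval (p i)
  rw [hP, Polynomial.eval_zero, Finset.sum_eq_single_of_mem i hi] at hPi
  · refine (mul_eq_zero.1 hPi.symm).resolve_right (Finset.prod_ne_zero_iff.2 fun k hk => ?_)
    exact sub_ne_zero.2 fun h => Finset.ne_of_mem_erase hk (hp (Finset.mem_of_mem_erase hk) hi h)
  · intro j _ hji
    rw [Finset.prod_eq_zero (Finset.mem_erase.2 ⟨hji.symm, hi⟩) (sub_self (p i)), mul_zero]

section CauchyRowIndependence

variable {A : ℝ → ℝ} {s : Finset ℝ} {c : ℝ → ℂ}

theorem sum_mul_cauchyKernel_eq_zero (hA : MemLp A 2 (volume : Measure ℝ))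
    (hc : ContinuousOn A {0}ᶜ) (hs : ∀ q ∈ s, q ≠ 0) (hsum : ∑ q ∈ s, c q • cauchyRow hA q = 0)
    {y : ℝ} (hy : y ≠ 0) : ∑ q ∈ s, c q * (cauchyKernel A q y : ℂ) = 0 := by
  have hae : (fun y => ∑ q ∈ s, c q * (cauchyKernel A q y : ℂ)) =ᵐ[volume] fun _ => 0 := by
    filter_upwards [coeFn_sum_smul_cauchyRow hA s c id, Lp.eq_zero_iff_ae_eq_zero.1 hsum]
      with y hcoe hzero
    exact hcoe.symm.trans hzero
  have hcont : ContinuousOn (fun y => ∑ q ∈ s, c q * (cauchyKernel A q y : ℂ)) {0}ᶜ :=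
    continuousOn_finsetSum _ fun q hq => continuousOn_const.mul
      (Complex.continuous_ofReal.comp_continuousOn ((continuousOn_cauchyKernel hc).comp
        (f := fun y => (q, y)) (by fun_prop) fun y hy => ⟨hs q hq, hy⟩))
  exact Measure.eqOn_open_of_ae_eq (ae_restrict_of_ae hae) isOpen_compl_singleton hcont
    continuousOn_const hy

theorem sum_mul_cauchyKernel_eq_mul_sum_div (A : ℝ → ℝ) (c : ℝ → ℂ) (s : Finset ℝ) {p y : ℝ}
    (hpy : p * y < 0) : ∑ q ∈ s, c q * (cauchyKernel A q y : ℂ) =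
      A y * ∑ q ∈ s with 0 < p * q, c q * A q / ((q : ℂ) - y) := by
  rw [Finset.mul_sum, Finset.sum_filter]
  refine Finset.sum_congr rfl fun q _ => ?_
  split_ifs with hpq
  · rw [cauchyKernel_of_mul_neg A ((mul_neg_iff_of_mul_pos hpq y).1 hpy)]
    push_cast
    ring
  · have hqy : 0 ≤ q * y := by
      by_contra! h
      nlinarith [mul_pos_of_neg_of_neg hpy h, mul_self_nonneg y]
    rw [cauchyKernel_of_mul_nonneg A hqy, Complex.ofReal_zero, mul_zero]

theorem eq_zero_of_sum_mul_cauchyKernel_eq_zero (hc : ContinuousOn A {0}ᶜ)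
    (hsum : ∀ y ≠ 0, ∑ q ∈ s, c q * (cauchyKernel A q y : ℂ) = 0) {p z : ℝ} (hp : p ∈ s)
    (hpz : cauchyKernel A p z ≠ 0) : c p = 0 := by
  obtain ⟨hpz, hAp, hAz⟩ := cauchyKernel_ne_zero_iff.1 hpz
  set Z : Set ℝ := {y | p * y < 0 ∧ A y ≠ 0}
  have hZ : Z.Infinite := by
    have hside : IsOpen {y : ℝ | p * y < 0} := isOpen_lt (by fun_prop) continuous_const
    have hAcont : ContinuousAt A z :=
      hc.continuousAt (isOpen_compl_singleton.mem_nhds (right_ne_zero_of_mul hpz.ne))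
    exact infinite_of_mem_nhds z
      (Filter.inter_mem (hside.mem_nhds hpz) (hAcont.eventually_ne hAz))
  have hpartial : ∀ y ∈ Z, ∑ q ∈ s with 0 < p * q, c q * A q / ((q : ℂ) - y) = 0 := by
    rintro y ⟨hpy, hAy⟩
    have hzero := hsum y (right_ne_zero_of_mul hpy.ne)
    rw [sum_mul_cauchyKernel_eq_mul_sum_div A c s hpy] at hzero
    exact (mul_eq_zero.1 hzero).resolve_left (Complex.ofReal_ne_zero.2 hAy)
  have hdisjoint : ∀ q ∈ {q ∈ s | 0 < p * q}, (q : ℂ) ∉ Complex.ofReal '' Z := by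
    rintro q hq ⟨y, ⟨hpy, -⟩, hqy⟩
    rw [Complex.ofReal_injective hqy] at hpy
    exact (Finset.mem_filter.1 hq).2.not_gt hpy
  have hp_mem : p ∈ {q ∈ s | 0 < p * q} :=
    Finset.mem_filter.2 ⟨hp, mul_self_pos.2 (left_ne_zero_of_mul hpz.ne)⟩
  have hcp : c p * A p = 0 := eq_zero_of_sum_div_sub_eq_zero (a := fun q => c q * (A q : ℂ))
    Complex.ofReal_injective.injOn (hZ.image Complex.ofReal_injective.injOn) hdisjoint
    (forall_mem_image.2 hpartial) hp_mem
  exact (mul_eq_zero.1 hcp).resolve_right (Complex.ofReal_ne_zero.2 hAp)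

theorem linearIndepOn_cauchyRow (hA : MemLp A 2 (volume : Measure ℝ))
    (hc : ContinuousOn A {0}ᶜ) :
    LinearIndepOn ℂ (cauchyRow hA) {q | ∃ z, cauchyKernel A q z ≠ 0} := by
  rw [linearIndepOn_iff']
  intro s c hs hsum p hp
  have hs0 : ∀ q ∈ s, q ≠ 0 := fun q hq => by
    obtain ⟨z, hz⟩ := hs hq
    exact left_ne_zero_of_mul (cauchyKernel_ne_zero_iff.1 hz).1.ne
  obtain ⟨z, hz⟩ := hs hp
  exact eq_zero_of_sum_mul_cauchyKernel_eq_zero hc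
    (fun y hy => sum_mul_cauchyKernel_eq_zero hA hc hs0 hsum hy) hp hz

end CauchyRowIndependence

theorem IsCauchyOperator.isPrincipallyNonsingular {L : H →L[ℂ] H} {A : ℝ → ℝ}
    (h : IsCauchyOperator L A) {K : ℝ → ℝ → ℂ} (hK : IsContinuousKernel K (KOp L)) :
    IsPrincipallyNonsingular K {q | ∃ z, cauchyKernel A q z ≠ 0} := by
  have hne : ∀ q ∈ {q | ∃ z, cauchyKernel A q z ≠ 0}, q ≠ 0 := fun q ⟨z, hz⟩ =>
    left_ne_zero_of_mul (cauchyKernel_ne_zero_iff.1 hz).1.ne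
  set R : H →L[ℂ] H := Ring.inverse (1 + L)
  have hinj : Function.Injective R := fun f g hfg =>
    calc f = R f + L (R f) := (inverse_one_add_apply_add h.mem_skewAdjoint f).symm
      _ = R g + L (R g) := by rw [hfg]
      _ = g := inverse_one_add_apply_add h.mem_skewAdjoint g
  refine isPrincipallyNonsingular_of_add_conj_eq_inner
    (v := fun q => R (cauchyRow h.memLp q)) (fun p hp q hq => ?_)
    ((linearIndepOn_cauchyRow h.memLp h.continuousOn).map_injOn
      R.toLinearMap hinj.injOn)
  have hKeq := fun {x y} => hK.unique h.isContinuousKernel_resolventKernel (x := x) (y := y)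
  rw [hKeq (hne p hp) (hne q hq), hKeq (hne q hq) (hne p hp), h.resolventKernel_add_conj_swap]

section PartialFractions

variable {ι F : Type*} [Field F] {s : Finset ι} {p : ι → F}

theorem exists_eval_div_prod_eq_sum_div (hp : InjOn p s) {P : Polynomial F}
    (hP : P.degree < s.card) : ∃ b : ι → F, ∀ y, (∀ i ∈ s, y ≠ p i) →
      P.eval y / ∏ i ∈ s, (y - p i) = ∑ i ∈ s, b i / (p i - y) := by
  classical
  refine ⟨fun i => -(Lagrange.nodalWeight s p i * P.eval (p i)), fun y hy => ?_⟩
  have hprod : ∏ i ∈ s, (y - p i) ≠ 0 :=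
    Finset.prod_ne_zero_iff.2 fun i hi => sub_ne_zero.2 (hy i hi)
  rw [div_eq_iff hprod, mul_comm, ← Lagrange.eval_nodal]
  conv_lhs => rw [Lagrange.eq_interpolate hp hP, Lagrange.eval_interpolate_not_at_node _ hy]
  congr 1
  refine Finset.sum_congr rfl fun i _ => ?_
  rw [← neg_sub y, neg_div_neg_eq, mul_right_comm, div_eq_mul_inv]

theorem exists_prod_div_sub_eq (hp : InjOn p s) {m : ι → F} {x : F} (hx : ∀ i ∈ s, x ≠ m i) :
    ∃ b : ι → F, ∀ y ≠ x, (∀ i ∈ s, y ≠ p i) →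
      (∏ i ∈ s, (x - p i) / (x - m i)) * (∏ i ∈ s, (y - m i) / (y - p i)) / (x - y) =
        1 / (x - y) + ∑ i ∈ s, b i / (p i - y) := by
  classical
  set c := ∏ i ∈ s, (x - p i) / (x - m i) with hc
  set P := Lagrange.nodal s p - c • Lagrange.nodal s m
  have hroot : P.IsRoot x := by
    have hm : ∏ i ∈ s, (x - m i) ≠ 0 :=
      Finset.prod_ne_zero_iff.2 fun i hi => sub_ne_zero.2 (hx i hi)
    simp [P, hc, Lagrange.eval_nodal, Finset.prod_div_distrib, hm]
  obtain ⟨Q, hQ⟩ := Polynomial.dvd_iff_isRoot.2 hroot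
  have hQdeg : Q.degree < s.card := by
    rcases eq_or_ne Q 0 with rfl | hQ0
    · simp
    have hP : P.degree ≤ s.card := by
      refine (Polynomial.degree_sub_le _ _).trans (max_le Lagrange.degree_nodal.le ?_)
      exact (Polynomial.degree_smul_le _ _).trans Lagrange.degree_nodal.le
    rw [hQ, Polynomial.degree_mul, Polynomial.degree_X_sub_C,
      Polynomial.degree_eq_natDegree hQ0] at hP
    rw [Polynomial.degree_eq_natDegree hQ0]
    norm_cast at hP ⊢
    omega
  obtain ⟨b, hb⟩ := exists_eval_div_prod_eq_sum_div hp hQdeg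
  refine ⟨b, fun y hyx hy => ?_⟩
  have hyQ : (y - x) * Q.eval y = ∏ i ∈ s, (y - p i) - c * ∏ i ∈ s, (y - m i) := by
    simpa [P, Lagrange.eval_nodal] using (congrArg (Polynomial.eval y) hQ).symm
  have hprod : ∏ i ∈ s, (y - p i) ≠ 0 :=
    Finset.prod_ne_zero_iff.2 fun i hi => sub_ne_zero.2 (hy i hi)
  have hxy : x - y ≠ 0 := sub_ne_zero.2 hyx.symm
  rw [← hb y hy, Finset.prod_div_distrib]
  field_simp
  linear_combination hyQ

end PartialFractions

section ProductWeight

variable {ι : Type*} [Fintype ι] {p m : ι → ℝ} {g A : ℝ → ℝ} {x : ℝ}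

theorem exists_cauchyKernel_mul_eq_add_sum (hp : Function.Injective p) (hAp : ∀ i, A (p i) ≠ 0)
    (hxp : ∀ i, 0 < x * p i) (hxm : ∀ i, x * m i < 0)
    (hgx : g x = ∏ i, (x - p i) / (x - m i))
    (hg : ∀ y, x * y < 0 → g y = ∏ i, (y - m i) / (y - p i)) :
    ∃ c : ι → ℝ, ∀ y, cauchyKernel (fun x => g x * A x) x y =
      cauchyKernel A x y + ∑ i, c i * cauchyKernel A (p i) y := by
  have hne {a b : ℝ} (hab : a * b < 0) : a ≠ b := fun h => by
    rw [h] at hab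
    exact (mul_self_nonneg b).not_gt hab
  obtain ⟨b, hb⟩ := exists_prod_div_sub_eq (s := Finset.univ) hp.injOn fun i _ => hne (hxm i)
  refine ⟨fun i => A x * b i / A (p i), fun y => ?_⟩
  rcases lt_or_ge (x * y) 0 with hxy | hxy
  · have hpy (i : ι) : p i * y < 0 := (mul_neg_iff_of_mul_pos (hxp i) y).1 hxy
    have hpart := hb y (hne hxy).symm fun i _ => (hne (hpy i)).symm
    calc cauchyKernel (fun x => g x * A x) x y
        = A x * A y * (g x * g y / (x - y)) := by
          rw [cauchyKernel_of_mul_neg _ hxy]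
          ring
      _ = A x * A y * (1 / (x - y) + ∑ i, b i / (p i - y)) := by rw [hgx, hg y hxy, hpart]
      _ = cauchyKernel A x y + ∑ i, A x * b i / A (p i) * cauchyKernel A (p i) y := by
          rw [cauchyKernel_of_mul_neg A hxy, mul_add, mul_one_div, Finset.mul_sum]
          congr 1
          refine Finset.sum_congr rfl fun i _ => ?_
          rw [cauchyKernel_of_mul_neg A (hpy i)]
          field_simp [hAp i]
  · have hpy (i : ι) : 0 ≤ p i * y :=
      not_lt.1 (mt (mul_neg_iff_of_mul_pos (hxp i) y).2 hxy.not_gt)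
    simp [cauchyKernel_of_mul_nonneg _ hxy, cauchyKernel_of_mul_nonneg _ (hpy _)]

theorem cauchyRow_mul_sub_mem_span (hA : MemLp A 2 (volume : Measure ℝ))
    (hgA : MemLp (fun x => g x * A x) 2 (volume : Measure ℝ)) (hp : Function.Injective p)
    (hAp : ∀ i, A (p i) ≠ 0) (hxp : ∀ i, 0 < x * p i) (hxm : ∀ i, x * m i < 0)
    (hgx : g x = ∏ i, (x - p i) / (x - m i))
    (hg : ∀ y, x * y < 0 → g y = ∏ i, (y - m i) / (y - p i)) :
    cauchyRow hgA x - cauchyRow hA x ∈ Submodule.span ℂ (cauchyRow hA '' range p) := by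
  obtain ⟨c, hc⟩ := exists_cauchyKernel_mul_eq_add_sum hp hAp hxp hxm hgx hg
  have hsum : cauchyRow hgA x - cauchyRow hA x = ∑ i, (c i : ℂ) • cauchyRow hA (p i) := by
    rw [sub_eq_iff_eq_add']
    ext1
    filter_upwards [coeFn_cauchyRow hgA x, coeFn_cauchyRow hA x,
      coeFn_sum_smul_cauchyRow hA Finset.univ (fun i => (c i : ℂ)) p,
      Lp.coeFn_add (cauchyRow hA x) (∑ i, (c i : ℂ) • cauchyRow hA (p i))]
      with y hgrow hrow hsum hadd
    rw [hadd, Pi.add_apply, hgrow, hrow, hsum, hc]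
    push_cast
    rfl
  rw [hsum]
  exact Submodule.sum_mem _ fun i _ => Submodule.smul_mem _ _
    (Submodule.subset_span (mem_image_of_mem _ (mem_range_self i)))

end ProductWeight

section MulOp

variable {g : ℝ → ℝ} (hg : MemLp (fun x => (g x : ℂ)) ∞ (volume : Measure ℝ))

theorem coeFn_mulOp (f : H) : (mulOp g hg f : ℝ → ℂ) =ᵐ[volume] fun x => g x * f x := by
  rw [mulOp, ContinuousLinearMap.holderL_apply_apply]
  filter_upwards [ContinuousLinearMap.coeFn_holder (r := 2) (ContinuousLinearMap.mul ℂ ℂ)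
    hg.toLp f, hg.coeFn_toLp] with x hmul hgx
  rw [hmul, hgx, ContinuousLinearMap.mul_apply']

theorem IsCauchyOperator.mulOp_conj {L : H →L[ℂ] H} {A : ℝ → ℝ} (h : IsCauchyOperator L A)
    (hgc : ContinuousOn g {0}ᶜ) :
    IsCauchyOperator (mulOp g hg * L * mulOp g hg) (fun x => g x * A x) where
  continuousOn := hgc.mul h.continuousOn
  memLp := h.memLp.mul (by simpa using hg.re)
  kernel := by
    intro f
    filter_upwards [h.kernel (mulOp g hg f), coeFn_mulOp hg (L (mulOp g hg f))]
      with x ⟨hint, hLx⟩ hgLx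
    have hker : (fun y => (g x : ℂ) * (cauchyKernel A x y * mulOp g hg f y)) =ᵐ[volume]
        fun y => (cauchyKernel (fun x => g x * A x) x y : ℂ) * f y := by
      filter_upwards [coeFn_mulOp hg f] with y hy
      rw [hy, cauchyKernel_mul]
      push_cast
      ring
    refine ⟨(hint.const_mul _).congr hker, ?_⟩
    rw [← integral_congr_ae hker, integral_const_mul, ← hLx, ← hgLx]
    rfl

end MulOp

section Weight

variable {n : ℕ} {pp pm : Fin n → ℝ}

theorem weight_of_pos (pp pm : Fin n → ℝ) {x : ℝ} (hx : 0 < x) :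
    weight pp pm x = ∏ i, (x - pp i) / (x - pm i) := by
  simp [weight, hx, hx.le]

theorem weight_of_neg (pp pm : Fin n → ℝ) {x : ℝ} (hx : x < 0) :
    weight pp pm x = ∏ i, (x - pm i) / (x - pp i) := by
  simp [weight, hx, hx.le]

theorem weight_eq_zero_of_mem (hpp : ∀ i, 0 < pp i) (hpm : ∀ i, pm i < 0) {q : ℝ}
    (hq : q ∈ range pp ∪ range pm) : weight pp pm q = 0 := by
  rcases hq with ⟨i, rfl⟩ | ⟨i, rfl⟩
  · rw [weight_of_pos _ _ (hpp i)]
    exact Finset.prod_eq_zero (Finset.mem_univ i) (by rw [sub_self, zero_div])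
  · rw [weight_of_neg _ _ (hpm i)]
    exact Finset.prod_eq_zero (Finset.mem_univ i) (by rw [sub_self, zero_div])

theorem continuousOn_weight (hpp : ∀ i, 0 < pp i) (hpm : ∀ i, pm i < 0) :
    ContinuousOn (weight pp pm) {0}ᶜ := by
  intro x (hx : x ≠ 0)
  apply ContinuousAt.continuousWithinAt
  rcases hx.lt_or_gt with hx | hx
  · have hprod : ContinuousAt (fun x => ∏ i, (x - pm i) / (x - pp i)) x :=
      tendsto_finsetProd _ fun i _ => ContinuousAt.div (by fun_prop) (by fun_prop)
        (sub_ne_zero.2 (hx.trans (hpp i)).ne)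
    refine hprod.congr ?_
    filter_upwards [gt_mem_nhds hx] with z hz
    exact (weight_of_neg pp pm hz).symm
  · have hprod : ContinuousAt (fun x => ∏ i, (x - pp i) / (x - pm i)) x :=
      tendsto_finsetProd _ fun i _ => ContinuousAt.div (by fun_prop) (by fun_prop)
        (sub_ne_zero.2 ((hpm i).trans hx).ne')
    refine hprod.congr ?_
    filter_upwards [lt_mem_nhds hx] with z hz
    exact (weight_of_pos pp pm hz).symm

theorem cauchyRow_weight_mul_sub_mem_span {A : ℝ → ℝ} (hA : MemLp A 2 (volume : Measure ℝ))
    (hwA : MemLp (fun x => weight pp pm x * A x) 2 (volume : Measure ℝ))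
    (hpp : ∀ i, 0 < pp i) (hpm : ∀ i, pm i < 0) (hpp_inj : Function.Injective pp)
    (hpm_inj : Function.Injective pm) (hApp : ∀ i, A (pp i) ≠ 0) (hApm : ∀ i, A (pm i) ≠ 0)
    {x : ℝ} (hx : x ≠ 0) : cauchyRow hwA x - cauchyRow hA x ∈
      Submodule.span ℂ (cauchyRow hA '' (range pp ∪ range pm)) := by
  rw [image_union]
  rcases hx.lt_or_gt with hx | hx
  · exact Submodule.span_mono subset_union_right (cauchyRow_mul_sub_mem_span hA hwA hpm_inj hApm
      (fun i => mul_pos_of_neg_of_neg hx (hpm i)) (fun i => mul_neg_of_neg_of_pos hx (hpp i))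
      (weight_of_neg pp pm hx) fun y hy => weight_of_pos pp pm ((neg_iff_pos_of_mul_neg hy).1 hx))
  · exact Submodule.span_mono subset_union_left (cauchyRow_mul_sub_mem_span hA hwA hpp_inj hApp
      (fun i => mul_pos hx (hpp i)) (fun i => mul_neg_of_pos_of_neg hx (hpm i))
      (weight_of_pos pp pm hx) fun y hy => weight_of_neg pp pm ((pos_iff_neg_of_mul_neg hy).1 hx))

end Weight

theorem IsContinuousKernel.continuousOn_row {K : ℝ → ℝ → ℂ} {T : H →L[ℂ] H}
    (hK : IsContinuousKernel K T) {x : ℝ} (hx : x ≠ 0) : ContinuousOn (K x) {0}ᶜ :=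
  hK.1.comp (f := fun y => (x, y)) (by fun_prop) fun _ hy => ⟨hx, hy⟩

namespace IsCauchyOperator

variable {L L' : H →L[ℂ] H} {A A' : ℝ → ℝ} {K K' : ℝ → ℝ → ℂ} {S : Set ℝ}

theorem conj_coeFn_inverse_cauchyRow_eq_kernel (h : IsCauchyOperator L A)
    (hK : IsContinuousKernel K (KOp L)) {x : ℝ} (hx : x ≠ 0) :
    (fun y => conj (Ring.inverse (1 - L) (cauchyRow h.memLp x) y)) =ᵐ[volume] K x := by
  filter_upwards [h.conj_coeFn_inverse_cauchyRow x, Measure.ae_ne volume (0 : ℝ)] with y hy hy0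
  rw [hy, h.isContinuousKernel_resolventKernel.unique hK hx hy0]

theorem exists_mem_span_kernel_ae_eq_conj (h : IsCauchyOperator L A)
    (hK : IsContinuousKernel K (KOp L)) (hS : ∀ q ∈ S, q ≠ 0) {f : H}
    (hf : f ∈ Submodule.span ℂ ((fun q => Ring.inverse (1 - L) (cauchyRow h.memLp q)) '' S)) :
    ∃ k ∈ Submodule.span ℂ (K '' S), ContinuousOn k {0}ᶜ ∧
      (fun y => conj (f y)) =ᵐ[volume] k := by
  induction hf using Submodule.span_induction with
  | mem f hf =>
    obtain ⟨q, hq, rfl⟩ := hf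
    exact ⟨K q, Submodule.subset_span (mem_image_of_mem K hq), hK.continuousOn_row (hS q hq),
      h.conj_coeFn_inverse_cauchyRow_eq_kernel hK (hS q hq)⟩
  | zero =>
    refine ⟨0, zero_mem _, continuousOn_const, ?_⟩
    filter_upwards [Lp.coeFn_zero ℂ 2 (volume : Measure ℝ)] with y hy
    rw [hy, Pi.zero_apply, map_zero]
  | add f f' _ _ hf hf' =>
    obtain ⟨k, hk, hkc, hfk⟩ := hf
    obtain ⟨k', hk', hkc', hfk'⟩ := hf'
    refine ⟨k + k', add_mem hk hk', hkc.add hkc', ?_⟩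
    filter_upwards [hfk, hfk', Lp.coeFn_add f f'] with y hy hy' hadd
    rw [hadd, Pi.add_apply, map_add, hy, hy', Pi.add_apply]
  | smul a f _ hf =>
    obtain ⟨k, hk, hkc, hfk⟩ := hf
    refine ⟨conj a • k, Submodule.smul_mem _ _ hk, hkc.const_smul _, ?_⟩
    filter_upwards [hfk, Lp.coeFn_smul a f] with y hy hsmul
    rw [hsmul, Pi.smul_apply, smul_eq_mul, map_mul, hy, Pi.smul_apply, smul_eq_mul]

theorem inverse_cauchyRow_sub_mem_span (h : IsCauchyOperator L A) (h' : IsCauchyOperator L' A')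
    (hS : S.Finite) (hrow : ∀ x ≠ 0, cauchyRow h'.memLp x - cauchyRow h.memLp x ∈
      Submodule.span ℂ (cauchyRow h.memLp '' S)) {x : ℝ} (hx : x ≠ 0) :
    Ring.inverse (1 - L') (cauchyRow h'.memLp x) - Ring.inverse (1 - L) (cauchyRow h.memLp x) ∈
      Submodule.span ℂ ((fun q => Ring.inverse (1 - L) (cauchyRow h.memLp q)) '' S) := by
  set V := Submodule.span ℂ (cauchyRow h.memLp '' S) with hV
  have : FiniteDimensional ℂ V := FiniteDimensional.span_of_finite ℂ (hS.image _)
  have hL : EqOn L' L Vᗮ := fun f hf => by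
    ext1
    filter_upwards [h.ae_apply f, h'.ae_apply f, Measure.ae_ne volume (0 : ℝ)] with z hz hz' hz0
    rw [hz, hz', ← sub_eq_zero, ← inner_sub_left]
    exact Submodule.inner_right_of_mem_orthogonal (hrow z hz0) hf
  have hmem := inverse_apply_sub_inverse_apply_mem_map h.mem_skewAdjoint h'.mem_skewAdjoint hL
    (hrow x hx)
  rwa [hV, Submodule.map_span, image_image] at hmem

theorem exists_mem_span_kernel_eq_add (h : IsCauchyOperator L A) (h' : IsCauchyOperator L' A')
    (hK : IsContinuousKernel K (KOp L)) (hK' : IsContinuousKernel K' (KOp L')) (hS : S.Finite)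
    (hS0 : ∀ q ∈ S, q ≠ 0) (hrow : ∀ x ≠ 0, cauchyRow h'.memLp x - cauchyRow h.memLp x ∈
      Submodule.span ℂ (cauchyRow h.memLp '' S)) {x : ℝ} (hx : x ≠ 0) :
    ∃ k ∈ Submodule.span ℂ (K '' S), ∀ y ≠ 0, K' x y = K x y + k y := by
  obtain ⟨k, hk, hkc, hae⟩ := h.exists_mem_span_kernel_ae_eq_conj hK hS0
    (h.inverse_cauchyRow_sub_mem_span h' hS hrow hx)
  refine ⟨k, hk, fun y hy => ?_⟩
  set s' := Ring.inverse (1 - L') (cauchyRow h'.memLp x)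
  set s := Ring.inverse (1 - L) (cauchyRow h.memLp x)
  have heq : K' x =ᵐ[volume] fun y => K x y + k y := by
    filter_upwards [h.conj_coeFn_inverse_cauchyRow_eq_kernel hK hx,
      h'.conj_coeFn_inverse_cauchyRow_eq_kernel hK' hx, hae, Lp.coeFn_sub s' s]
      with y hKy hKy' hky hsub
    rw [← hKy, ← hKy', ← hky, hsub, Pi.sub_apply, map_sub, add_sub_cancel]
  exact Measure.eqOn_open_of_ae_eq (ae_restrict_of_ae heq) isOpen_compl_singleton
    (hK'.continuousOn_row hx) ((hK.continuousOn_row hx).add hkc) hy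

theorem kernel_apply_eq_zero (h : IsCauchyOperator L A) (hK : IsContinuousKernel K (KOp L))
    {x q : ℝ} (hx : x ≠ 0) (hq : q ≠ 0) (hAq : A q = 0) : K x q = 0 := by
  have hker (y : ℝ) : cauchyKernel A q y = 0 := by
    by_contra hne
    exact (cauchyKernel_ne_zero_iff.1 hne).2.1 hAq
  have hrow : cauchyRow h.memLp q = 0 := by
    rw [Lp.eq_zero_iff_ae_eq_zero]
    filter_upwards [coeFn_cauchyRow h.memLp q] with y hy
    rw [hy, hker, Complex.ofReal_zero, Pi.zero_apply]
  rw [hK.unique h.isContinuousKernel_resolventKernel hx hq, resolventKernel, hrow, map_zero,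
    inner_zero_right, cauchyKernel_swap, hker, neg_zero, Complex.ofReal_zero, zero_add]

theorem palmKernel_eq (h : IsCauchyOperator L A) (h' : IsCauchyOperator L' A')
    (hK : IsContinuousKernel K (KOp L)) (hK' : IsContinuousKernel K' (KOp L')) {l : List ℝ}
    (hl : l.Nodup) (hlA : ∀ q ∈ l, ∃ z, cauchyKernel A q z ≠ 0) (hlA' : ∀ q ∈ l, A' q = 0)
    (hrow : ∀ x ≠ 0, cauchyRow h'.memLp x - cauchyRow h.memLp x ∈
      Submodule.span ℂ (cauchyRow h.memLp '' {q | q ∈ l})) {x y : ℝ} (hx : x ≠ 0) (hy : y ≠ 0) :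
    palmKernel K l x y = K' x y := by
  have hl0 : ∀ q ∈ l, q ≠ 0 := fun q hq => by
    obtain ⟨z, hz⟩ := hlA q hq
    exact left_ne_zero_of_mul (cauchyKernel_ne_zero_iff.1 hz).1.ne
  obtain ⟨k, hk, hKk⟩ := h.exists_mem_span_kernel_eq_add h' hK hK' l.finite_toSet hl0 hrow hx
  have hvanish : ∀ q ∈ l, K x q + k q = 0 := fun q hq => by
    rw [← hKk q (hl0 q hq), h'.kernel_apply_eq_zero hK' hx (hl0 q hq) (hlA' q hq)]
  rw [palmKernel_eq_add_of_mem_span hl ((h.isPrincipallyNonsingular hK).mono hlA) hk hvanish,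
    Pi.add_apply, hKk y hy]

end IsCauchyOperator

theorem nodup_ofFn_append_ofFn {n : ℕ} {pp pm : Fin n → ℝ} (hpp : ∀ i, 0 < pp i)
    (hpm : ∀ i, pm i < 0) (hpp_inj : Function.Injective pp) (hpm_inj : Function.Injective pm) :
    (List.ofFn pp ++ List.ofFn pm).Nodup := by
  rw [List.nodup_append', List.nodup_ofFn, List.nodup_ofFn]
  refine ⟨hpp_inj, hpm_inj, fun q hq hq' => ?_⟩
  obtain ⟨i, rfl⟩ := (List.mem_ofFn' pp q).1 hq
  obtain ⟨j, hj⟩ := (List.mem_ofFn' pm _).1 hq'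
  exact ((hpm j).trans (hpp i)).ne hj

theorem exists_cauchyKernel_ne_zero {n : ℕ} {pp pm : Fin n → ℝ} {A : ℝ → ℝ}
    (hpp : ∀ i, 0 < pp i) (hpm : ∀ i, pm i < 0) (hApp : ∀ i, A (pp i) ≠ 0)
    (hApm : ∀ i, A (pm i) ≠ 0) {q : ℝ} (hq : q ∈ range pp ∪ range pm) :
    ∃ z, cauchyKernel A q z ≠ 0 := by
  rcases hq with ⟨i, rfl⟩ | ⟨i, rfl⟩
  · exact ⟨pm i, cauchyKernel_ne_zero_iff.2 ⟨mul_neg_of_pos_of_neg (hpp i) (hpm i), hApp i, hApm i⟩⟩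
  · exact ⟨pp i, cauchyKernel_ne_zero_iff.2 ⟨mul_neg_of_neg_of_pos (hpm i) (hpp i), hApm i, hApp i⟩⟩

end

end PalmKernel

open PalmKernel in
theorem mainTheorem10_general (L : H →L[ℂ] H) (A : ℝ → ℝ) (hL : IsCauchyOperator L A)
    (n : ℕ) (pp pm : Fin n → ℝ)
    (hpp : ∀ i, 0 < pp i) (hpm : ∀ i, pm i < 0)
    (hpp_inj : Function.Injective pp) (hpm_inj : Function.Injective pm)
    (hApp : ∀ i, A (pp i) ≠ 0) (hApm : ∀ i, A (pm i) ≠ 0) :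
    IsUnit (1 + L) ∧ IsUnit (1 + weightConj pp pm hpp hpm L) ∧
    (∃ K, IsContinuousKernel K (KOp L)) ∧
    (∃ K', IsContinuousKernel K' (KOp (weightConj pp pm hpp hpm L))) ∧
    ∀ K K' : ℝ → ℝ → ℂ,
      IsContinuousKernel K (KOp L) →
      IsContinuousKernel K' (KOp (weightConj pp pm hpp hpm L)) →
      ∀ q : List ℝ, q.Perm (List.ofFn pp ++ List.ofFn pm) →
      ∀ x y : ℝ, x ≠ 0 → y ≠ 0 → palmKernel K q x y = K' x y := by
  have hL' : IsCauchyOperator (weightConj pp pm hpp hpm L) (fun x => weight pp pm x * A x) :=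
    hL.mulOp_conj (weight_memLp hpp hpm) (continuousOn_weight hpp hpm)
  refine ⟨hL.isUnit_one_add, hL'.isUnit_one_add, ⟨_, hL.isContinuousKernel_resolventKernel⟩,
    ⟨_, hL'.isContinuousKernel_resolventKernel⟩, fun K K' hK hK' q hq x y hx hy => ?_⟩
  have hmem : {a | a ∈ q} = range pp ∪ range pm := by
    ext a
    simp [hq.mem_iff, List.mem_ofFn']
  refine hL.palmKernel_eq hL' hK hK'
    (hq.nodup_iff.2 (nodup_ofFn_append_ofFn hpp hpm hpp_inj hpm_inj))
    (fun a ha => exists_cauchyKernel_ne_zero hpp hpm hApp hApm (hmem.subset ha))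
    (fun a ha => by rw [weight_eq_zero_of_mem hpp hpm (hmem.subset ha), zero_mul])
    (fun z hz => ?_) hx hy
  rw [hmem]
  exact cauchyRow_weight_mul_sub_mem_span hL.memLp hL'.memLp hpp hpm hpp_inj hpm_inj hApp hApm hz

open PalmKernel in
theorem mainTheorem10 (L : H →L[ℂ] H) (A : ℝ → ℝ) (hL : IsAdmissible L A)
    (n : ℕ) (pp pm : Fin n → ℝ)
    (hpp : ∀ i, 0 < pp i) (hpm : ∀ i, pm i < 0)
    (hpp_inj : Function.Injective pp) (hpm_inj : Function.Injective pm)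
    (hApp : ∀ i, A (pp i) ≠ 0) (hApm : ∀ i, A (pm i) ≠ 0) :
    IsUnit (1 + L) ∧ IsUnit (1 + weightConj pp pm hpp hpm L) ∧
    (∃ K, IsContinuousKernel K (KOp L)) ∧
    (∃ K', IsContinuousKernel K' (KOp (weightConj pp pm hpp hpm L))) ∧
    ∀ K K' : ℝ → ℝ → ℂ,
      IsContinuousKernel K (KOp L) →
      IsContinuousKernel K' (KOp (weightConj pp pm hpp hpm L)) →
      ∀ q : List ℝ, q.Perm (List.ofFn pp ++ List.ofFn pm) →
      ∀ x y : ℝ, x ≠ 0 → y ≠ 0 → palmKernel K q x y = K' x y := by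
  exact mainTheorem10_general L A ⟨hL.contDiffOn.continuousOn, hL.memLp, hL.kernel⟩ n pp pm
    hpp hpm hpp_inj hpm_inj hApp hApm
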